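/- Let $\mathbb T=\mathbb R_+=[0,+\infty)$ or $\mathbb T=\mathbb R$, let $\tau>0$, and let $f\in C(\mathbb T\times\mathbb R,\mathbb R)$, the space of continuous real-valued functions on $\mathbb T\times\mathbb R$ with the compact-open topology. For $h\in\mathbb T$ let $f^h(t,x):=f(t+h,x)$, and put $H(f):=\overline{\{f^h : h\in\mathbb T\}}$ and $H^+(f):=\overline{\{f^h : h\in\mathbb R_+\}}$, the closures being taken in $C(\mathbb T\times\mathbb R,\mathbb R)$. The function $f$ is called regular (respectively, positively regular) if for every $u\in\mathbb R$ and every $g\in H(f)$ (respectively, $g\in H^+(f)$) the equation $x'=g(t,x)$ has a unique solution on $\mathbb R_+$ with $x(0)=u$. Suppose that $f$ is asymptotically $\tau$-periodic in $t$, uniformly with respect to $x$ on compact sets; that is, there are $P,R\in C(\mathbb T\times\mathbb R,\mathbb R)$ with $f=P+R$, $P(t+\tau,x)=P(t,x)$ for all $(t,x)\in\mathbb T\times\mathbb R$, and $\lim_{t\to+\infty}|R(t,x)|=0$ uniformly with respect to $x$ on every compact subset of $\mathbb R$. Let $\varphi$ be a solution of $x'=f(t,x)$ on $\mathbb R_+$,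 with $\varphi(0)=u_0\in\mathbb R$, that is bounded on $\mathbb R_+$. If $f$ is regular, then $\varphi$ is $S$-asymptotically $\tau$-periodic, i.e. $$\lim_{t\to+\infty}|\varphi(t+\tau)-\varphi(t)|=0 .$$ The same conclusion holds if $f$ is only assumed to be positively regular. -/

import Mathlib

open Set Filter Topology

namespace ScalarODE

/-- The `h`-translate `f^h(t, x) = f(t + h, x)` of a continuous function on `T × ℝ`,
where the time domain `T` is an additive submonoid of `ℝ`. -/
def timeShift {T : AddSubmonoid ℝ} (h : T) (f : C(T × ℝ, ℝ)) : C(T × ℝ, ℝ) where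
  toFun p := f (p.1 + h, p.2)
  continuous_toFun := by fun_prop

/-- The hull `H(f)`: the closure of all translates of `f`, for the compact-open topology. -/
def hull {T : AddSubmonoid ℝ} (f : C(T × ℝ, ℝ)) : Set C(T × ℝ, ℝ) :=
  closure {g | ∃ h : T, g = timeShift h f}

/-- The positive hull `H⁺(f)`: the closure of all translates of `f` by nonnegative times. -/
def positiveHull {T : AddSubmonoid ℝ} (f : C(T × ℝ, ℝ)) : Set C(T × ℝ, ℝ) :=
  closure {g | ∃ h : T, 0 ≤ (h : ℝ) ∧ g = timeShift h f}

/-- `x` is, on `[0, ∞)`, a solution of `x' = g(t, x)` with `x(0) = u` (one-sided derivative at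
`t = 0`). Only the values of `x` on `[0, ∞)` matter. The time domain `T` is meant to
contain `[0, ∞)`. -/
def IsSolution {T : AddSubmonoid ℝ} (g : C(T × ℝ, ℝ)) (u : ℝ) (x : ℝ → ℝ) : Prop :=
  x 0 = u ∧ ∀ t : T, 0 ≤ (t : ℝ) → HasDerivWithinAt x (g (t, x t)) (Ici 0) (t : ℝ)

/-- For every initial value `u`, the equation `x' = g(t, x)` has exactly one solution on `[0, ∞)`
with `x(0) = u`. -/
def UniquelySolvable {T : AddSubmonoid ℝ} (g : C(T × ℝ, ℝ)) : Prop :=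
  ∀ u : ℝ, (∃ x : ℝ → ℝ, IsSolution g u x) ∧
    ∀ x y : ℝ → ℝ, IsSolution g u x → IsSolution g u y → EqOn x y (Ici 0)

/-- `f` is regular: every equation in the hull `H(f)` is uniquely solvable on `[0, ∞)`. -/
def IsRegularField {T : AddSubmonoid ℝ} (f : C(T × ℝ, ℝ)) : Prop :=
  ∀ g ∈ hull f, UniquelySolvable g

/-- `f` is positively regular: every equation in the positive hull `H⁺(f)` is uniquely solvable
on `[0, ∞)`. -/
def IsPositivelyRegularField {T : AddSubmonoid ℝ} (f : C(T × ℝ, ℝ)) : Prop :=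
  ∀ g ∈ positiveHull f, UniquelySolvable g

/-- `f` is asymptotically `τ`-periodic in `t`, uniformly with respect to `x` on compact sets:
`f = P + R` with `P` and `R` continuous, `P` being `τ`-periodic in `t`, and `R(t, x) → 0` as
`t → +∞` uniformly for `x` in any compact set. -/
def IsAsymptoticallyPeriodic {T : AddSubmonoid ℝ} (τ : T) (f : C(T × ℝ, ℝ)) : Prop :=
  ∃ P R : C(T × ℝ, ℝ),
    (∀ (t : T) (x : ℝ), f (t, x) = P (t, x) + R (t, x)) ∧
    (∀ (t : T) (x : ℝ), P (t + τ, x) = P (t, x)) ∧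
    ∀ K : Set ℝ, IsCompact K →
      TendstoUniformlyOn (fun (t : T) (x : ℝ) => R (t, x)) (fun _ => 0) atTop K

/-- `x` is `S`-asymptotically `τ`-periodic: `|x(t + τ) - x(t)| → 0` as `t → +∞`. -/
def IsSAsymptoticallyPeriodic (τ : ℝ) (x : ℝ → ℝ) : Prop :=
  Tendsto (fun t : ℝ => |x (t + τ) - x t|) atTop (𝓝 0)

end ScalarODE

/-!
Write `f = P + R` with `P` periodic and `R → 0`, let `φ` be the bounded solution, and look at the
translates `φ (· + n τ)`. They are bounded and share a Lipschitz constant, so along every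
ultrafilter on `ℕ` tending to infinity they converge locally uniformly on `[0, ∞)` to a solution
`ψ` of the periodic equation `x' = P(t, x)` (`exists_limit_solution`).

The translates of `P` by nonnegative times belong to the positive hull of `f`
(`timeShift_mem_positiveHull`), so they are uniquely solvable, and since the equation is scalar its
solutions keep their order (`IsSolution.le_of_le`). In terms of the samples `a n = φ (n τ)` this
says that the limit pairs of `(a n, a (n + 1))`, which are the pairs `(ψ 0, ψ τ)`, depend
monotonically on their first entry. If some pair had `ψ 0 < ψ τ`, then monotonicity would trap the
samples above a level exceeding `ψ 0`, and `ψ 0` would not be a limit point; the case `ψ τ < ψ 0` is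
symmetric (`eq_of_monotone_limit_pairs`). Hence `ψ τ = ψ 0`, and uniqueness makes every limit
solution `τ`-periodic.

Finally, write `t = r + n τ` with `r ∈ [0, τ]`. Along any ultrafilter of times tending to infinity
`r` converges to some `s`, and `φ (t + τ) - φ t` converges to `ψ (s + τ) - ψ s = 0`.

Only the positive hull enters, and it is contained in the hull, so regularity is covered as well.
Limits along ultrafilters replace the extraction of subsequences.
-/

namespace ScalarODE

/-! ### Limits along ultrafilters -/

theorem exists_tendsto_of_abs_le {ι : Type*} (U : Ultrafilter ι) {a : ι → ℝ} {M : ℝ}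
    (ha : ∀ᶠ i in (U : Filter ι), |a i| ≤ M) : ∃ α, |α| ≤ M ∧ Tendsto a U (𝓝 α) := by
  obtain ⟨α, hα, h⟩ := (isCompact_Icc (a := -M) (b := M)).ultrafilter_le_nhds (U.map a)
    (le_principal_iff.2 (by
      change ∀ᶠ i in (U : Filter ι), a i ∈ Icc (-M) M
      filter_upwards [ha] with i hi using abs_le.1 hi))
  exact ⟨α, abs_le.2 hα, h⟩

/-- If the limit pairs `(lim a n, lim a (n + 1))` of a bounded sequence depend monotonically on
their first entry, then the second entry never exceeds the first. Otherwise, for a pair `α < α'`,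
monotonicity makes `(α - δ, ∞)` a trap: each later term that enters it is followed only by terms
above the midpoint of `α` and `α'`, so `α` cannot be a limit point. -/
theorem le_of_monotone_limit_pairs {a : ℕ → ℝ} {M : ℝ} (ha : ∀ n, |a n| ≤ M)
    (hmono : ∀ (U V : Ultrafilter ℕ) (α α' β β' : ℝ), (U : Filter ℕ) ≤ atTop →
      (V : Filter ℕ) ≤ atTop → Tendsto a U (𝓝 α) → Tendsto (fun n => a (n + 1)) U (𝓝 α') →
      Tendsto a V (𝓝 β) → Tendsto (fun n => a (n + 1)) V (𝓝 β') → α ≤ β → α' ≤ β')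
    {U : Ultrafilter ℕ} (hU : (U : Filter ℕ) ≤ atTop) {α α' : ℝ}
    (hα : Tendsto a U (𝓝 α)) (hα' : Tendsto (fun n => a (n + 1)) U (𝓝 α')) : α' ≤ α := by
  by_contra! hlt
  obtain ⟨c, hc, hc'⟩ := exists_between hlt
  have trap : ∃ δ > 0, ∀ᶠ n in atTop, α - δ < a n → c ≤ a (n + 1) := by
    by_contra! hno
    have hk : ∀ k : ℕ, ∃ n ≥ k, α - 1 / ((k : ℝ) + 1) < a n ∧ a (n + 1) < c := by
      intro k
      have := frequently_atTop.1 (hno (1 / ((k : ℝ) + 1)) (by positivity)) k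
      obtain ⟨n, hn, h⟩ := this
      exact ⟨n, hn, h⟩
    choose n hn h₁ h₂ using hk
    have hn' : Tendsto n (hyperfilter ℕ) atTop :=
      (tendsto_atTop_mono hn tendsto_id).mono_left
        ((hyperfilter_le_cofinite).trans Nat.cofinite_eq_atTop.le)
    let V : Ultrafilter ℕ := (hyperfilter ℕ).map n
    obtain ⟨β, -, hβ⟩ := exists_tendsto_of_abs_le V (Eventually.of_forall ha)
    obtain ⟨β', -, hβ'⟩ := exists_tendsto_of_abs_le V (a := fun n => a (n + 1))
      (Eventually.of_forall fun n => ha (n + 1))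
    have hαβ : α ≤ β := by
      have hl : Tendsto (fun k : ℕ => α - 1 / ((k : ℝ) + 1)) (hyperfilter ℕ) (𝓝 (α - 0)) :=
        (tendsto_const_nhds.sub tendsto_one_div_add_atTop_nhds_zero_nat).mono_left
          ((hyperfilter_le_cofinite).trans Nat.cofinite_eq_atTop.le)
      rw [sub_zero] at hl
      exact le_of_tendsto_of_tendsto' hl (tendsto_map'_iff.1 hβ) fun k => (h₁ k).le
    have hβc : β' ≤ c := le_of_tendsto' (tendsto_map'_iff.1 hβ') fun k => (h₂ k).le
    exact absurd ((hmono U V α α' β β' hU hn' hα hα' hβ hβ' hαβ).trans hβc) (not_le.2 hc')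
  obtain ⟨δ, hδ, htrap⟩ := trap
  obtain ⟨N, hN⟩ := eventually_atTop.1 htrap
  obtain ⟨n, hn, hnN⟩ := ((hα.eventually (lt_mem_nhds (sub_lt_self α hδ))).and
    (hU (eventually_ge_atTop N))).exists
  have hge : ∀ m ≥ n + 1, c ≤ a m := by
    intro m hm
    induction m, hm using Nat.le_induction with
    | base => exact hN n hnN hn
    | succ m hm ih => exact hN m (by omega) (by linarith)
  exact absurd (ge_of_tendsto hα (hU (eventually_atTop.2 ⟨n + 1, hge⟩))) (not_le.2 hc)

/-- Both inequalities of the previous lemma: applied to `-a`, whose limit pairs are again monotone,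
it bounds the second entry from below. -/
theorem eq_of_monotone_limit_pairs {a : ℕ → ℝ} {M : ℝ} (ha : ∀ n, |a n| ≤ M)
    (hmono : ∀ (U V : Ultrafilter ℕ) (α α' β β' : ℝ), (U : Filter ℕ) ≤ atTop →
      (V : Filter ℕ) ≤ atTop → Tendsto a U (𝓝 α) → Tendsto (fun n => a (n + 1)) U (𝓝 α') →
      Tendsto a V (𝓝 β) → Tendsto (fun n => a (n + 1)) V (𝓝 β') → α ≤ β → α' ≤ β')
    {U : Ultrafilter ℕ} (hU : (U : Filter ℕ) ≤ atTop) {α α' : ℝ}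
    (hα : Tendsto a U (𝓝 α)) (hα' : Tendsto (fun n => a (n + 1)) U (𝓝 α')) : α' = α := by
  refine le_antisymm (le_of_monotone_limit_pairs ha hmono hU hα hα') (neg_le_neg_iff.1 ?_)
  refine le_of_monotone_limit_pairs (a := fun n => -a n) (M := M) (by simpa using ha) ?_ hU
    hα.neg hα'.neg
  intro U V α α' β β' hU hV h₁ h₂ h₃ h₄ hle
  have := hmono V U (-β) (-β') (-α) (-α') hV hU (by simpa using h₃.neg) (by simpa using h₄.neg)
    (by simpa using h₁.neg) (by simpa using h₂.neg) (neg_le_neg hle)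
  exact neg_le_neg_iff.1 this

/-! ### Solutions, translates and order -/

section Solutions

variable {T : AddSubmonoid ℝ}

theorem IsSolution.continuousOn (hT : ∀ t : ℝ, 0 ≤ t → t ∈ T) {g : C(T × ℝ, ℝ)} {u : ℝ}
    {x : ℝ → ℝ} (hx : IsSolution g u x) : ContinuousOn x (Ici 0) :=
  fun t ht => (hx.2 ⟨t, hT t ht⟩ ht).continuousWithinAt

theorem IsSolution.shift {g : C(T × ℝ, ℝ)} {u : ℝ} {x : ℝ → ℝ} (hx : IsSolution g u x) {h : T}
    (hh : 0 ≤ (h : ℝ)) : IsSolution (timeShift h g) (x h) fun t => x (t + h) := by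
  refine ⟨by simp, fun t ht => ?_⟩
  have h₁ := hx.2 (t + h) (by push_cast; positivity)
  have h₂ : HasDerivWithinAt (fun s : ℝ => s + (h : ℝ)) 1 (Ici 0) (t : ℝ) :=
    (hasDerivWithinAt_id _ _).add_const _
  have h₃ := HasDerivWithinAt.scomp (t : ℝ) (t' := Ici (0 : ℝ))
    (by simpa using h₁) h₂ (fun s hs => by
      have : (0 : ℝ) ≤ s := hs
      simp only [mem_Ici]; positivity)
  simpa [timeShift, Function.comp_def] using h₃

/-- Solutions of a scalar equation keep their order: after a first meeting time `s`, uniqueness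
for the equation translated by `s` makes them coincide. -/
theorem IsSolution.le_of_le (hT : ∀ t : ℝ, 0 ≤ t → t ∈ T) {g : C(T × ℝ, ℝ)}
    (hg : ∀ h : T, 0 ≤ (h : ℝ) → UniquelySolvable (timeShift h g)) {u v : ℝ} {x y : ℝ → ℝ}
    (hx : IsSolution g u x) (hy : IsSolution g v y) (huv : u ≤ v) {t : ℝ} (ht : 0 ≤ t) :
    x t ≤ y t := by
  by_contra! hlt
  have hsub : Icc 0 t ⊆ Ici (0 : ℝ) := fun s hs => hs.1
  obtain ⟨s, hs, hs0⟩ : (0 : ℝ) ∈ (fun s => x s - y s) '' Icc 0 t :=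
    intermediate_value_Icc ht (((hx.continuousOn hT).mono hsub).sub
      ((hy.continuousOn hT).mono hsub)) ⟨by simpa [hx.1, hy.1] using huv, by simpa using hlt.le⟩
  have hxy : x s = y s := sub_eq_zero.1 hs0
  have h₁ := hx.shift (h := ⟨s, hT s hs.1⟩) hs.1
  have h₂ := hy.shift (h := ⟨s, hT s hs.1⟩) hs.1
  have := ((hg ⟨s, hT s hs.1⟩ hs.1) (x s)).2 _ _ h₁ (by simpa [hxy] using h₂)
    (show t - s ∈ Ici 0 from sub_nonneg.2 hs.2)
  simp only [sub_add_cancel] at this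
  exact hlt.ne' this

theorem add_nsmul_eq_of_periodic {P : C(T × ℝ, ℝ)} {τ : T}
    (hP : ∀ (t : T) (x : ℝ), P (t + τ, x) = P (t, x)) (n : ℕ) (t : T) (x : ℝ) :
    P (t + n • τ, x) = P (t, x) := by
  induction n with
  | zero => simp
  | succ n ih => rw [succ_nsmul, ← add_assoc, hP, ih]

theorem tendsto_const_add_nsmul_atTop {τ : T} (hτ : 0 < (τ : ℝ)) (s : ℝ) :
    Tendsto (fun n : ℕ => s + n * (τ : ℝ)) atTop atTop :=
  tendsto_atTop_add_const_left _ _ (tendsto_natCast_atTop_atTop.atTop_mul_const hτ)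

/-- The translates by nonnegative times of the periodic part `P` of `f = P + R` are limits of
`f` translated by `h + n τ`, hence lie in the positive hull. -/
theorem timeShift_mem_positiveHull {f P R : C(T × ℝ, ℝ)} {τ : T} (hτ : 0 < (τ : ℝ))
    (hf : ∀ (t : T) (x : ℝ), f (t, x) = P (t, x) + R (t, x))
    (hP : ∀ (t : T) (x : ℝ), P (t + τ, x) = P (t, x))
    (hR : ∀ K : Set ℝ, IsCompact K →
      TendstoUniformlyOn (fun (t : T) (x : ℝ) => R (t, x)) (fun _ => 0) atTop K)
    {h : T} (hh : 0 ≤ (h : ℝ)) : timeShift h P ∈ positiveHull f := by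
  refine mem_closure_of_tendsto (f := fun n : ℕ => timeShift (h + n • τ) f) (b := atTop) ?_
    (Eventually.of_forall fun n => ⟨h + n • τ, by push_cast; positivity, rfl⟩)
  rw [ContinuousMap.tendsto_iff_forall_isCompact_tendstoUniformlyOn]
  intro K hK
  rw [Metric.tendstoUniformlyOn_iff]
  intro ε hε
  obtain ⟨t₀, ht₀⟩ := eventually_atTop.1
    (Metric.tendstoUniformlyOn_iff.1 (hR _ (hK.image continuous_snd)) ε hε)
  obtain ⟨b, hb⟩ := (hK.image (continuous_subtype_val.comp continuous_fst)).bddBelow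
  filter_upwards [(tendsto_const_add_nsmul_atTop hτ (b + h)).eventually_ge_atTop (t₀ : ℝ)]
    with n hn p hp
  have hbp : b ≤ (p.1 : ℝ) := hb ⟨p, hp, rfl⟩
  have hle : t₀ ≤ p.1 + (h + n • τ) := by
    rw [← Subtype.coe_le_coe]; push_cast
    simp only [nsmul_eq_mul]; linarith
  have := ht₀ _ hle p.2 ⟨p, hp, rfl⟩
  have hper : P (p.1 + (h + n • τ), p.2) = P (p.1 + h, p.2) := by
    rw [← add_assoc, add_nsmul_eq_of_periodic hP]
  simpa [timeShift, hf, hper, Real.dist_eq] using this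

end Solutions

/-! ### Limit solutions of a bounded solution -/

section LimitSolutions

variable {T : AddSubmonoid ℝ}

/-- The retraction `t ↦ max t 0` of `ℝ` onto `[0, ∞)`, viewed in the time domain. -/
def toTime (hT : ∀ t : ℝ, 0 ≤ t → t ∈ T) (t : ℝ) : T := ⟨max t 0, hT _ (le_max_right _ _)⟩

theorem continuous_toTime (hT : ∀ t : ℝ, 0 ≤ t → t ∈ T) : Continuous (toTime hT) :=
  Continuous.subtype_mk (by fun_prop) _

theorem coe_toTime (hT : ∀ t : ℝ, 0 ≤ t → t ∈ T) {t : ℝ} (ht : 0 ≤ t) :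
    (toTime hT t : ℝ) = t := max_eq_left ht

theorem toTime_coe (hT : ∀ t : ℝ, 0 ≤ t → t ∈ T) {t : T} (ht : 0 ≤ (t : ℝ)) :
    toTime hT t = t := Subtype.ext (coe_toTime hT ht)

theorem toTime_add_nsmul (hT : ∀ t : ℝ, 0 ≤ t → t ∈ T) {τ : T} (hτ : 0 < (τ : ℝ)) {t : ℝ}
    (ht : 0 ≤ t) (n : ℕ) : toTime hT (t + n * (τ : ℝ)) = toTime hT t + n • τ := by
  refine Subtype.ext ?_
  rw [coe_toTime hT (by positivity)]
  push_cast
  rw [coe_toTime hT ht, nsmul_eq_mul]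

theorem exists_bound_on_compact (hT : ∀ t : ℝ, 0 ≤ t → t ∈ T) (g : C(T × ℝ, ℝ)) (b M : ℝ) :
    ∃ C, ∀ (t : T) (x : ℝ), 0 ≤ (t : ℝ) → (t : ℝ) ≤ b → |x| ≤ M → |g (t, x)| ≤ C := by
  have hK := ((isCompact_Icc (a := (0 : ℝ)) (b := b)).image (continuous_toTime hT)).prod
    (isCompact_Icc (a := -M) (b := M))
  obtain ⟨C, hC⟩ := hK.exists_bound_of_continuousOn g.continuous.continuousOn
  exact ⟨C, fun t x h₀ hb hx => hC (t, x) ⟨⟨t, ⟨h₀, hb⟩, toTime_coe hT h₀⟩, abs_le.1 hx⟩⟩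

theorem exists_bound_of_asymptoticallyPeriodic (hT : ∀ t : ℝ, 0 ≤ t → t ∈ T)
    {f P R : C(T × ℝ, ℝ)} {τ : T} (hτ : 0 < (τ : ℝ))
    (hf : ∀ (t : T) (x : ℝ), f (t, x) = P (t, x) + R (t, x))
    (hP : ∀ (t : T) (x : ℝ), P (t + τ, x) = P (t, x))
    (hR : ∀ K : Set ℝ, IsCompact K →
      TendstoUniformlyOn (fun (t : T) (x : ℝ) => R (t, x)) (fun _ => 0) atTop K) (M : ℝ) :
    ∃ C, ∀ (t : T) (x : ℝ), 0 ≤ (t : ℝ) → |x| ≤ M → |f (t, x)| ≤ C := by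
  obtain ⟨t₀, ht₀⟩ := eventually_atTop.1 (Metric.tendstoUniformlyOn_iff.1
    (hR (Icc (-M) M) isCompact_Icc) 1 one_pos)
  obtain ⟨C₁, hC₁⟩ := exists_bound_on_compact hT f t₀ M
  obtain ⟨C₂, hC₂⟩ := exists_bound_on_compact hT P τ M
  refine ⟨max C₁ (C₂ + 1), fun t x ht hx => ?_⟩
  rcases le_total t t₀ with h | h
  · exact (hC₁ t x ht h hx).trans (le_max_left _ _)
  · refine le_trans ?_ (le_max_right _ _)
    rw [hf]
    have h₁ : |R (t, x)| ≤ 1 := by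
      have := ht₀ t h x (abs_le.1 hx)
      simpa using this.le
    set n := ⌊(t : ℝ) / τ⌋₊
    have hn : (n : ℝ) * τ ≤ t := (le_div_iff₀ hτ).1 (Nat.floor_le (by positivity))
    have hn' : (t : ℝ) < (n + 1) * τ := (div_lt_iff₀ hτ).1 (Nat.lt_floor_add_one _)
    have h₀ : 0 ≤ (t : ℝ) - n * τ := sub_nonneg.2 hn
    have ht' : t = toTime hT ((t : ℝ) - n * τ) + n • τ := by
      rw [← toTime_add_nsmul hT hτ h₀, sub_add_cancel, toTime_coe hT ht]
    have h₂ : |P (t, x)| ≤ C₂ := by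
      rw [ht', add_nsmul_eq_of_periodic hP]
      refine hC₂ _ x ?_ ?_ hx <;> rw [coe_toTime hT h₀]
      · exact h₀
      · linarith
    exact (abs_add_le _ _).trans (add_le_add h₂ h₁)

/-- A bounded solution of an equation with bounded right-hand side is Lipschitz on `[0, ∞)`. -/
theorem IsSolution.exists_abs_sub_le (hT : ∀ t : ℝ, 0 ≤ t → t ∈ T) {f : C(T × ℝ, ℝ)} {u M C : ℝ}
    {φ : ℝ → ℝ} (hφ : IsSolution f u φ) (hM : ∀ t, 0 ≤ t → |φ t| ≤ M)
    (hC : ∀ (t : T) (x : ℝ), 0 ≤ (t : ℝ) → |x| ≤ M → |f (t, x)| ≤ C) {s t : ℝ} (hs : 0 ≤ s)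
    (ht : 0 ≤ t) : |φ t - φ s| ≤ C * |t - s| :=
  (convex_Ici 0).norm_image_sub_le_of_norm_hasDerivWithin_le
    (f' := fun t => f (toTime hT t, φ t))
    (fun r (hr : 0 ≤ r) => by
      have := hφ.2 (toTime hT r) (by rwa [coe_toTime hT hr])
      rwa [coe_toTime hT hr] at this)
    (fun r (hr : 0 ≤ r) => hC _ _ (by rwa [coe_toTime hT hr]) (hM r hr)) hs ht

/-- Along an ultrafilter on `ℕ` tending to infinity, the translates `t ↦ φ (t + n τ)` of a bounded
solution converge, locally uniformly on `[0, ∞)`, to a solution of the periodic equation.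
Boundedness yields pointwise limits, the common Lipschitz constant upgrades them to convergence
jointly in `n` and `t`, and then the right-hand sides converge in the same sense. -/
theorem exists_limit_solution (hT : ∀ t : ℝ, 0 ≤ t → t ∈ T)
    {f P R : C(T × ℝ, ℝ)} {τ : T} (hτ : 0 < (τ : ℝ))
    (hf : ∀ (t : T) (x : ℝ), f (t, x) = P (t, x) + R (t, x))
    (hP : ∀ (t : T) (x : ℝ), P (t + τ, x) = P (t, x))
    (hR : ∀ K : Set ℝ, IsCompact K →
      TendstoUniformlyOn (fun (t : T) (x : ℝ) => R (t, x)) (fun _ => 0) atTop K)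
    {u M : ℝ} {φ : ℝ → ℝ} (hφ : IsSolution f u φ) (hM : ∀ t, 0 ≤ t → |φ t| ≤ M)
    {U : Ultrafilter ℕ} (hU : (U : Filter ℕ) ≤ atTop) :
    ∃ ψ : ℝ → ℝ, IsSolution P (ψ 0) ψ ∧ ∀ t, 0 ≤ t →
      Tendsto (fun p : ℕ × ℝ => φ (p.2 + p.1 * (τ : ℝ))) ((U : Filter ℕ) ×ˢ 𝓝[Ici 0] t)
        (𝓝 (ψ t)) := by
  obtain ⟨C, hC⟩ := exists_bound_of_asymptoticallyPeriodic hT hτ hf hP hR M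
  have hlip : ∀ (n : ℕ) {s t : ℝ}, 0 ≤ s → 0 ≤ t →
      |φ (t + n * (τ : ℝ)) - φ (s + n * (τ : ℝ))| ≤ C * |t - s| := by
    intro n s t hs ht
    have := hφ.exists_abs_sub_le hT hM hC (s := s + n * (τ : ℝ)) (t := t + n * (τ : ℝ))
      (by positivity) (by positivity)
    simpa using this
  have hpt : ∀ t : ℝ, ∃ α, 0 ≤ t → Tendsto (fun n : ℕ => φ (t + n * (τ : ℝ))) U (𝓝 α) := by
    intro t
    by_cases ht : 0 ≤ t
    · obtain ⟨α, -, hα⟩ := exists_tendsto_of_abs_le U (a := fun n : ℕ => φ (t + n * (τ : ℝ)))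
        (M := M) (Eventually.of_forall fun n => hM _ (by positivity))
      exact ⟨α, fun _ => hα⟩
    · exact ⟨0, fun h => absurd h ht⟩
  choose ψ hψ using hpt
  have hψlip : ∀ {s t : ℝ}, 0 ≤ s → 0 ≤ t → |ψ t - ψ s| ≤ C * |t - s| := fun hs ht =>
    le_of_tendsto' ((hψ _ ht).sub (hψ _ hs)).abs fun n => hlip n hs ht
  have hψcont : ContinuousOn ψ (Ici 0) := by
    intro t ht
    rw [ContinuousWithinAt, tendsto_iff_dist_tendsto_zero]
    have h0 : Tendsto (fun s : ℝ => C * |s - t|) (𝓝[Ici 0] t) (𝓝 0) := by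
      have : Continuous fun s : ℝ => C * |s - t| := by fun_prop
      simpa using (this.tendsto t).mono_left nhdsWithin_le_nhds
    refine squeeze_zero' (Eventually.of_forall fun _ => dist_nonneg) ?_ h0
    filter_upwards [self_mem_nhdsWithin] with s hs using hψlip ht hs
  have hjoint : ∀ t, 0 ≤ t → Tendsto (fun p : ℕ × ℝ => φ (p.2 + p.1 * (τ : ℝ)))
      ((U : Filter ℕ) ×ˢ 𝓝[Ici 0] t) (𝓝 (ψ t)) := by
    intro t ht
    have h0 : Tendsto (fun p : ℕ × ℝ => C * |p.2 - t|) ((U : Filter ℕ) ×ˢ 𝓝[Ici 0] t)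
        (𝓝 0) := by
      have : Continuous fun s : ℝ => C * |s - t| := by fun_prop
      have h := ((this.tendsto t).mono_left (nhdsWithin_le_nhds (s := Ici 0))).comp
        (tendsto_snd (f := (U : Filter ℕ)))
      simpa [Function.comp_def] using h
    have h1 : Tendsto (fun p : ℕ × ℝ => φ (p.2 + p.1 * (τ : ℝ)) - φ (t + p.1 * (τ : ℝ)))
        ((U : Filter ℕ) ×ˢ 𝓝[Ici 0] t) (𝓝 0) := by
      refine squeeze_zero_norm' ?_ h0
      filter_upwards [tendsto_snd.eventually self_mem_nhdsWithin] with p hp using hlip p.1 ht hp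
    simpa using h1.add ((hψ t ht).comp (tendsto_fst (g := 𝓝[Ici 0] t)))
  have hRlim : ∀ t, 0 ≤ t → Tendsto (fun p : ℕ × ℝ =>
      R (toTime hT (p.2 + p.1 * (τ : ℝ)), φ (p.2 + p.1 * (τ : ℝ))))
      ((U : Filter ℕ) ×ˢ 𝓝[Ici 0] t) (𝓝 0) := by
    intro t ht
    rw [Metric.tendsto_nhds]
    intro ε hε
    obtain ⟨t₀, ht₀⟩ := eventually_atTop.1 (Metric.tendstoUniformlyOn_iff.1
      (hR (Icc (-M) M) isCompact_Icc) ε hε)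
    filter_upwards [tendsto_snd.eventually self_mem_nhdsWithin, tendsto_fst.eventually
      (hU ((tendsto_const_add_nsmul_atTop hτ 0).eventually_ge_atTop (t₀ : ℝ)))] with p hp hn
    have hp : 0 ≤ p.2 := hp
    have hp' : 0 ≤ p.2 + p.1 * (τ : ℝ) := by positivity
    rw [dist_comm]
    refine ht₀ _ ?_ _ (abs_le.1 (hM _ hp'))
    rw [← Subtype.coe_le_coe, coe_toTime hT hp']
    linarith
  have hflim : ∀ t, 0 ≤ t → Tendsto (fun p : ℕ × ℝ =>
      f (toTime hT (p.2 + p.1 * (τ : ℝ)), φ (p.2 + p.1 * (τ : ℝ))))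
      ((U : Filter ℕ) ×ˢ 𝓝[Ici 0] t) (𝓝 (P (toTime hT t, ψ t))) := by
    intro t ht
    have h1 : Tendsto (fun p : ℕ × ℝ => P (toTime hT p.2, φ (p.2 + p.1 * (τ : ℝ))))
        ((U : Filter ℕ) ×ˢ 𝓝[Ici 0] t) (𝓝 (P (toTime hT t, ψ t))) :=
      (P.continuous.tendsto _).comp (Tendsto.prodMk_nhds
        ((((continuous_toTime hT).tendsto t).mono_left nhdsWithin_le_nhds).comp tendsto_snd)
        (hjoint t ht))
    have h2 := h1.add (hRlim t ht)
    rw [add_zero] at h2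
    refine h2.congr' ?_
    filter_upwards [tendsto_snd.eventually self_mem_nhdsWithin] with p hp
    rw [hf, toTime_add_nsmul hT hτ hp, add_nsmul_eq_of_periodic hP]
  have hPcont : ∀ t, 0 ≤ t → Tendsto (fun s => P (toTime hT s, ψ s)) (𝓝[Ici 0] t)
      (𝓝 (P (toTime hT t, ψ t))) := fun t ht =>
    (P.continuous.tendsto _).comp (Tendsto.prodMk_nhds
      (((continuous_toTime hT).tendsto t).mono_left nhdsWithin_le_nhds) (hψcont t ht))
  have hderiv : ∀ t, 0 < t → HasDerivAt ψ (P (toTime hT t, ψ t)) t := by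
    intro t ht
    refine hasDerivAt_of_tendstoLocallyUniformlyOn (l := (U : Filter ℕ)) (s := Ioi 0)
      (f := fun n t => φ (t + n * (τ : ℝ)))
      (f' := fun n t => f (toTime hT (t + n * (τ : ℝ)), φ (t + n * (τ : ℝ))))
      (g' := fun t => P (toTime hT t, ψ t))
      isOpen_Ioi ?_ (Eventually.of_forall fun n s hs => ?_) (fun s hs => hψ s (le_of_lt hs)) ht
    · rw [tendstoLocallyUniformlyOn_iff_forall_tendsto]
      intro s hs
      have hle : (U : Filter ℕ) ×ˢ 𝓝[Ioi 0] s ≤ (U : Filter ℕ) ×ˢ 𝓝[Ici 0] s :=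
        prod_mono le_rfl (nhdsWithin_mono _ Ioi_subset_Ici_self)
      exact ((((hPcont s (le_of_lt hs)).comp tendsto_snd).prodMk_nhds
        (hflim s (le_of_lt hs))).mono_right (nhds_le_uniformity _)).mono_left hle
    · have hs : 0 < s := hs
      have hs' : 0 < s + n * (τ : ℝ) := by positivity
      have h := hφ.2 (toTime hT (s + n * (τ : ℝ))) (by rw [coe_toTime hT hs'.le]; exact hs'.le)
      rw [coe_toTime hT hs'.le] at h
      exact (h.hasDerivAt (Ici_mem_nhds hs')).comp_add_const s (n * (τ : ℝ))
  refine ⟨ψ, ⟨rfl, fun t ht => ?_⟩, hjoint⟩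
  rcases ht.lt_or_eq with h | h
  · have := hderiv t h
    rw [toTime_coe hT ht] at this
    exact this.hasDerivWithinAt
  -- At the left endpoint the derivative is the limit of the derivatives at positive times.
  · have h0 := hPcont 0 le_rfl
    have key : HasDerivWithinAt ψ (P (toTime hT 0, ψ 0)) (Ici 0) 0 := by
      refine hasDerivWithinAt_Ici_of_tendsto_deriv (s := Ioi 0)
        (fun s hs => (hderiv s hs).differentiableAt.differentiableWithinAt)
        ((hψcont 0 self_mem_Ici).mono Ioi_subset_Ici_self) self_mem_nhdsWithin ?_
      refine (h0.mono_left (nhdsWithin_mono _ Ioi_subset_Ici_self)).congr' ?_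
      filter_upwards [self_mem_nhdsWithin] with s hs using (hderiv s hs).deriv.symm
    have hz : toTime hT 0 = t := by rw [h, toTime_coe hT ht]
    rw [← h, ← hz]
    exact key

end LimitSolutions

/-! ### Asymptotic periodicity -/

theorem isSAsymptoticallyPeriodic_of_isPositivelyRegularField {T : AddSubmonoid ℝ}
    (hT : ∀ t : ℝ, 0 ≤ t → t ∈ T) {f : C(T × ℝ, ℝ)} {τ : T} (hτ : 0 < (τ : ℝ))
    (hf : IsAsymptoticallyPeriodic τ f) (hreg : IsPositivelyRegularField f)
    {u M : ℝ} {φ : ℝ → ℝ} (hφ : IsSolution f u φ) (hM : ∀ t, 0 ≤ t → |φ t| ≤ M) :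
    IsSAsymptoticallyPeriodic (τ : ℝ) φ := by
  obtain ⟨P, R, hfPR, hP, hR⟩ := hf
  have hPuniq : ∀ h : T, 0 ≤ (h : ℝ) → UniquelySolvable (timeShift h P) := fun h hh =>
    hreg _ (timeShift_mem_positiveHull hτ hfPR hP hR hh)
  have hlim := fun (U : Ultrafilter ℕ) (hU : (U : Filter ℕ) ≤ atTop) =>
    exists_limit_solution hT hτ hfPR hP hR hφ hM hU
  have hseq : ∀ (U : Filter ℕ) {ψ : ℝ → ℝ} {t : ℝ}, 0 ≤ t →
      Tendsto (fun p : ℕ × ℝ => φ (p.2 + p.1 * (τ : ℝ))) (U ×ˢ 𝓝[Ici 0] t) (𝓝 (ψ t)) →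
      Tendsto (fun n : ℕ => φ (t + n * (τ : ℝ))) U (𝓝 (ψ t)) := fun U ψ t ht h =>
    h.comp (tendsto_id.prodMk (tendsto_const_nhdsWithin (mem_Ici.2 ht)))
  have hsucc : ∀ n : ℕ, (τ : ℝ) + n * τ = 0 + ((n + 1 : ℕ) : ℝ) * τ := fun n => by
    push_cast; ring
  -- Every limit solution takes the same value at `0` and at `τ`.
  have hperiod : ∀ (U : Ultrafilter ℕ), (U : Filter ℕ) ≤ atTop → ∀ ψ : ℝ → ℝ,
      (∀ t, 0 ≤ t → Tendsto (fun p : ℕ × ℝ => φ (p.2 + p.1 * (τ : ℝ)))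
        ((U : Filter ℕ) ×ˢ 𝓝[Ici 0] t) (𝓝 (ψ t))) → ψ τ = ψ 0 := by
    intro U hU ψ hψ
    refine eq_of_monotone_limit_pairs (a := fun n : ℕ => φ (0 + n * (τ : ℝ))) (M := M)
      (fun n => hM _ (by positivity)) ?_ hU (hseq U le_rfl (hψ 0 le_rfl))
      (by simpa only [hsucc] using hseq U hτ.le (hψ τ hτ.le))
    intro U V α α' β β' hU hV h₁ h₂ h₃ h₄ hle
    obtain ⟨x, hx, hxl⟩ := hlim U hU
    obtain ⟨y, hy, hyl⟩ := hlim V hV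
    have e₁ := tendsto_nhds_unique h₁ (hseq U le_rfl (hxl 0 le_rfl))
    have e₂ := tendsto_nhds_unique h₂ (by simpa only [hsucc] using hseq U hτ.le (hxl τ hτ.le))
    have e₃ := tendsto_nhds_unique h₃ (hseq V le_rfl (hyl 0 le_rfl))
    have e₄ := tendsto_nhds_unique h₄ (by simpa only [hsucc] using hseq V hτ.le (hyl τ hτ.le))
    rw [e₂, e₄]
    exact hx.le_of_le hT hPuniq hy (by rwa [← e₁, ← e₃]) hτ.le
  by_contra hno
  rw [IsSAsymptoticallyPeriodic, tendsto_iff_ultrafilter] at hno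
  push Not at hno
  obtain ⟨V, hV, hnV⟩ := hno
  refine hnV ?_
  -- Write `t = r + n τ` with `r ∈ [0, τ]`; along `V` the remainder `r` converges to some `s`.
  let n : ℝ → ℕ := fun t => ⌊t / τ⌋₊
  let r : ℝ → ℝ := fun t => t - n t * τ
  have hr : ∀ᶠ t in (V : Filter ℝ), 0 ≤ r t ∧ r t ≤ τ := by
    filter_upwards [hV (eventually_ge_atTop 0)] with t ht
    have ht : 0 ≤ t := ht
    have h₁ : (n t : ℝ) * τ ≤ t := (le_div_iff₀ hτ).1 (Nat.floor_le (by positivity))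
    have h₂ : t < (n t + 1) * τ := (div_lt_iff₀ hτ).1 (Nat.lt_floor_add_one _)
    exact ⟨sub_nonneg.2 h₁, by simp only [r]; linarith⟩
  have hn : Tendsto n V atTop :=
    (tendsto_nat_floor_atTop.comp (tendsto_id.atTop_div_const hτ)).mono_left hV
  obtain ⟨s, -, hs⟩ := exists_tendsto_of_abs_le V (a := r) (M := τ) (by
    filter_upwards [hr] with t ht using abs_le.2 ⟨by linarith, ht.2⟩)
  have hs0 : 0 ≤ s := ge_of_tendsto hs (hr.mono fun t ht => ht.1)
  obtain ⟨ψ, hψ, hψl⟩ := hlim (V.map n) hn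
  have hper : ψ (s + τ) = ψ s := by
    have h₁ := hψ.shift (h := τ) hτ.le
    have hPτ : timeShift τ P = P := ContinuousMap.ext fun p => hP p.1 p.2
    have hP0 := hPuniq τ hτ.le
    rw [hPτ] at h₁ hP0
    rw [hperiod (V.map n) hn ψ hψl] at h₁
    exact (hP0 _).2 _ _ h₁ hψ hs0
  have hmap : Tendsto n V (V.map n : Ultrafilter ℕ) := tendsto_map
  have h₁ : Tendsto φ V (𝓝 (ψ s)) := by
    have := (hψl s hs0).comp (hmap.prodMk (tendsto_nhdsWithin_iff.2
      ⟨hs, hr.mono fun t ht => ht.1⟩))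
    simpa [Function.comp_def, r] using this
  have h₂ : Tendsto (fun t => φ (t + τ)) V (𝓝 (ψ (s + τ))) := by
    have := (hψl (s + τ) (by positivity)).comp (hmap.prodMk (tendsto_nhdsWithin_iff.2
      ⟨hs.add_const (τ : ℝ), hr.mono fun t ht => add_nonneg ht.1 hτ.le⟩))
    refine this.congr fun t => ?_
    simp only [Function.comp_def, r]
    congr 1; ring
  rw [hper] at h₂
  simpa using (h₂.sub h₁).abs

theorem positiveHull_subset_hull {T : AddSubmonoid ℝ} (f : C(T × ℝ, ℝ)) :
    positiveHull f ⊆ hull f :=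
  closure_mono fun _ ⟨h, _, hg⟩ => ⟨h, hg⟩

end ScalarODE

theorem mainTheorem1 (T : AddSubmonoid ℝ) (hT : T = AddSubmonoid.nonneg ℝ ∨ T = ⊤)
    (f : C(T × ℝ, ℝ)) (τ : T) (hτ : 0 < (τ : ℝ))
    (hf : ScalarODE.IsAsymptoticallyPeriodic τ f)
    (u₀ : ℝ) (φ : ℝ → ℝ) (hφ : ScalarODE.IsSolution f u₀ φ)
    (hbdd : ∃ M : ℝ, ∀ t : ℝ, 0 ≤ t → |φ t| ≤ M) :
    (ScalarODE.IsRegularField f → ScalarODE.IsSAsymptoticallyPeriodic (τ : ℝ) φ) ∧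
    (ScalarODE.IsPositivelyRegularField f → ScalarODE.IsSAsymptoticallyPeriodic (τ : ℝ) φ) := by
  obtain ⟨M, hM⟩ := hbdd
  have hT' : ∀ t : ℝ, 0 ≤ t → t ∈ T := by
    rcases hT with rfl | rfl
    · exact fun t ht => ht
    · exact fun t _ => AddSubmonoid.mem_top t
  have key : ScalarODE.IsPositivelyRegularField f →
      ScalarODE.IsSAsymptoticallyPeriodic (τ : ℝ) φ := fun hreg =>
    ScalarODE.isSAsymptoticallyPeriodic_of_isPositivelyRegularField hT' hτ hf hreg hφ hM
  exact ⟨fun h => key fun g hg => h g (ScalarODE.positiveHull_subset_hull f hg), key⟩
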